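/- Let $\Sigma$ be a finite non-empty alphabet. A perfect binary tree of height $h\in\mathbb N$ over $\Sigma$ is a binary tree all of whose branches have length $h$, whose internal nodes are labelled by symbols of $\Sigma$ and whose leaves are labelled by complex numbers. Two trees of the same height are compatible if their internal labels agree; the sum of compatible trees adds the leaf values, the sum of incompatible trees is undefined, and $c\cdot t$ multiplies all leaf values of $t$ by $c\in\mathbb C$. An undefined operand makes the result undefined. A linear form over a finite set $Q$ is a partial function $v$ from $Q$ to $\mathbb C$ with non-empty domain $\mathrm{supp}(v)$. A synchronized weighted tree automaton (SWTA) over $\Sigma$ is a tuple $\mathcal A=(Q,\delta,C,q_0,E)$ with a finite set $Q$ of states, a finite non-empty set $C$ of colors, a root state $q_0\in Q$, a set $E\subseteq Q$ of leaf states and a partial transition function $\delta$ from $Q\times\Sigma\times C$ to pairs of linear forms over $Q$. For $q\in Q$ and $w\in(\Sigma\times C)^*$ the (possibly undefined) tree $[\![\mathcal A,q]\!](w)$ is given by: $[\![\mathcal A,q]\!](\epsilon)$ is the single leaf $1$ if $q\in E$, and is undefined otherwise; if $\delta(q,a,c)=(\ell,r)$, then $[\![\mathcal A,q]\!]((a,c)u)$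 is the tree with root label $a$, left subtree $\sum_{p\in\mathrm{supp}(\ell)}\ell(p)\cdot[\![\mathcal A,p]\!](u)$ and right subtree $\sum_{p\in\mathrm{supp}(r)}r(p)\cdot[\![\mathcal A,p]\!](u)$, and it is undefined if $\delta(q,a,c)$ or one of the two sums is undefined. The language of $\mathcal A$ is the set of trees $L(\mathcal A)=\{[\![\mathcal A,q_0]\!](w)\mid w\in(\Sigma\times C)^*,\ [\![\mathcal A,q_0]\!](w)\text{ is defined}\}$. **Theorem.** SWTAs are not closed under language intersection and are not closed under language complement. That is, over every finite non-empty alphabet $\Sigma$: 1. there are SWTAs $\mathcal A,\mathcal B$ over $\Sigma$ such that no SWTA $\mathcal C$ over $\Sigma$ satisfies $L(\mathcal C)=L(\mathcal A)\cap L(\mathcal B)$; 2. there is an SWTA $\mathcal A$ over $\Sigma$ such that no SWTA $\mathcal C$ over $\Sigma$ satisfies $L(\mathcal C)=T_\Sigma\setminus L(\mathcal A)$, where $T_\Sigma$ is the set of all perfect binary trees over $\Sigma$. -/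

import Mathlib

namespace SWTA

/-- Perfect binary trees of height `n`: internal nodes carry symbols from the alphabet `A`,
and all the leaves lie at depth `n` and carry complex numbers. -/
inductive TreeOfHeight (A : Type*) : ℕ → Type _
  | leaf (z : ℂ) : TreeOfHeight A 0
  | node {n : ℕ} (a : A) (l r : TreeOfHeight A n) : TreeOfHeight A (n + 1)

/-- The set of all perfect binary trees over `A` (of arbitrary finite height). -/
abbrev PerfectTree (A : Type*) := Σ n : ℕ, TreeOfHeight A n

namespace TreeOfHeight

variable {A : Type*}

/-- The sum of two trees of the same height. It is undefined (`none`) unless the trees are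
compatible, that is, carry the same symbols at all internal nodes; if they are,
the values of the leaves are added. -/
noncomputable def add : {n : ℕ} → TreeOfHeight A n → TreeOfHeight A n → Option (TreeOfHeight A n)
  | _, leaf x, leaf y => some (leaf (x + y))
  | _, node a l r, node b l' r' =>
    open Classical in
    if a = b then (add l l').bind fun s => (add r r').map fun t => node a s t else none

/-- The product of a scalar and a tree: all leaves are multiplied by the scalar. -/
noncomputable def smul (c : ℂ) : {n : ℕ} → TreeOfHeight A n → TreeOfHeight A n
  | _, leaf x => leaf (c * x)
  | _, node a l r => node a (smul c l) (smul c r)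

/-- Addition of possibly undefined trees; the result is undefined if one of the operands is. -/
noncomputable def oadd {n : ℕ} (s t : Option (TreeOfHeight A n)) : Option (TreeOfHeight A n) :=
  s.bind fun x => t.bind fun y => add x y

/-- The sum of a list of possibly undefined trees. (The sum of the empty list, which has no
meaningful value, is undefined; linear forms never give rise to it.) -/
noncomputable def sumList {n : ℕ} : List (Option (TreeOfHeight A n)) → Option (TreeOfHeight A n)
  | [] => none
  | [t] => t
  | t :: u :: l => oadd t (sumList (u :: l))

theorem add_comm {n : ℕ} (s t : TreeOfHeight A n) : add s t = add t s := by
  induction s with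
  | leaf x => cases t with
    | leaf y => simp [add, _root_.add_comm]
  | node a l r ihl ihr => cases t with
    | node b l' r' =>
      by_cases h : a = b
      · subst h; simp [add, ihl l', ihr r']
      · simp [add, h, Ne.symm h]

theorem oadd_comm {n : ℕ} (s t : Option (TreeOfHeight A n)) : oadd s t = oadd t s := by
  cases s <;> cases t <;> simp [oadd, add_comm]

theorem add_assoc {n : ℕ} (s t u : TreeOfHeight A n) :
    (add s t).bind (fun x => add x u) = (add t u).bind (fun x => add s x) := by
  induction s with
  | leaf x => cases t with
    | leaf y => cases u with
      | leaf z => simp [add, _root_.add_assoc]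
  | node a l r ihl ihr => cases t with
    | node b l' r' => cases u with
      | node c l'' r'' =>
        have hl := ihl l' l''
        have hr := ihr r' r''
        clear ihl ihr
        by_cases h : a = b
        · subst h
          by_cases h' : a = c
          · subst h'
            simp only [add, if_true]
            generalize add l l' = x1, add l' l'' = x2, add r r' = x3, add r' r'' = x4 at *
            cases x1 <;> cases x2 <;> cases x3 <;> cases x4 <;>
              simp_all [add, eq_comm (a := none)]
          · simp only [add, if_true, if_neg h']
            generalize add l l' = x1, add r r' = x3
            cases x1 <;> cases x3 <;> simp [add, h']
        · by_cases h' : b = c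
          · simp only [add, if_neg h, if_pos h']
            generalize add l' l'' = x1, add r' r'' = x3
            cases x1 <;> cases x3 <;> simp [add, h]
          · simp [add, h, h']

theorem oadd_assoc {n : ℕ} (s t u : Option (TreeOfHeight A n)) :
    oadd (oadd s t) u = oadd s (oadd t u) := by
  cases s <;> cases t <;> cases u <;> simp [oadd, add_assoc]

/-- The sum does not depend on the order of the summands. -/
theorem sumList_perm {n : ℕ} {l l' : List (Option (TreeOfHeight A n))} (h : l.Perm l') :
    sumList l = sumList l' := by
  induction h with
  | nil => rfl
  | cons x h ih =>
    rename_i l₁ l₂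
    cases l₁ with
    | nil => rw [h.nil_eq]
    | cons y l₁ => cases l₂ with
      | nil => exact absurd h.eq_nil (by simp)
      | cons z l₂ => simp only [sumList]; rw [ih]
  | swap x y l =>
    cases l with
    | nil => simp [sumList, oadd_comm]
    | cons z l =>
      simp only [sumList]
      rw [← oadd_assoc, ← oadd_assoc, oadd_comm y x]
  | trans _ _ ih₁ ih₂ => exact ih₁.trans ih₂

end TreeOfHeight

/-- A linear form over `Q`: a partial map from `Q` to `ℂ` that is defined somewhere. A state
outside the support differs from a state in the support whose coefficient is `0`. -/
structure LinForm (Q : Type) where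
  coeff : Q → Option ℂ
  nonempty : ∃ q, (coeff q).isSome

namespace LinForm

variable {Q : Type} {A : Type*}

/-- The set of states at which the linear form is defined. -/
noncomputable def supp [Fintype Q] (v : LinForm Q) : Finset Q :=
  Finset.univ.filter fun q => (v.coeff q).isSome

/-- The summand `v[q] · τ q`. -/
noncomputable def term {n : ℕ} (v : LinForm Q) (τ : Q → Option (TreeOfHeight A n)) (q : Q) :
    Option (TreeOfHeight A n) :=
  (v.coeff q).bind fun c => (τ q).map fun t => TreeOfHeight.smul c t

/-- The value of the linear form when each state `q` is replaced by the (possibly undefined)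
tree `τ q`: the sum of `v[q] · τ q` over all `q` in the support of `v`. -/
noncomputable def eval [Fintype Q] {n : ℕ} (v : LinForm Q) (τ : Q → Option (TreeOfHeight A n)) :
    Option (TreeOfHeight A n) :=
  TreeOfHeight.sumList (v.supp.toList.map (v.term τ))

end LinForm

/-- A synchronized weighted tree automaton over the alphabet `A`. -/
structure Automaton (A : Type*) where
  /-- the finite set of states -/
  State : Type
  [fintypeState : Fintype State]
  /-- the finite non-empty set of colors -/
  Color : Type
  [fintypeColor : Fintype Color]
  [nonemptyColor : Nonempty Color]
  /-- the partial transition function -/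
  trans : State → A → Color → Option (LinForm State × LinForm State)
  /-- the root state -/
  root : State
  /-- the set of leaf states -/
  leafStates : Set State

attribute [instance] Automaton.fintypeState Automaton.fintypeColor Automaton.nonemptyColor

namespace Automaton

variable {A : Type*}

/-- The tree function of the state `q`: a partial function from words over symbol-color pairs
to trees. The tree of a word has the length of the word as its height. -/
noncomputable def treeFun (M : Automaton A) :
    (w : List (A × M.Color)) → M.State → Option (TreeOfHeight A w.length)
  | [], q => open Classical in if q ∈ M.leafStates then some (TreeOfHeight.leaf 1) else none
  | (a, c) :: u, q =>
    (M.trans q a c).bind fun lr =>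
      (lr.1.eval (M.treeFun u)).bind fun tl =>
        (lr.2.eval (M.treeFun u)).map fun tr => TreeOfHeight.node a tl tr

/-- The language of the automaton: the set of all values of the tree function of the root. -/
def language (M : Automaton A) : Set (PerfectTree A) :=
  {t | ∃ w : List (A × M.Color), ∃ s : TreeOfHeight A w.length,
    M.treeFun w M.root = some s ∧ t = ⟨w.length, s⟩}

end Automaton

end SWTA

/-!
Complement: an automaton over a finite alphabet has countably many words, so its language is
countable, whereas there are uncountably many perfect trees, already of height `0`. Hence the
complement of a language is never a language.

Intersection: the set of heights of the trees in a language is ultimately periodic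
(`SWTA.Automaton.heights_eventually_periodic`). Indeed all the trees produced by a word `w` carry
the labels of `w` at their internal nodes, so sums are never undefined because of
incompatible labels. Whether the tree of a state is defined at `w` is then decided by a subset
construction reading `w` from its last letter, and the family of sets of states reached at
height `n` is the `n`-th iterate of a map on a finite type.

On the other hand, over a fixed symbol one can build the constant trees whose leaves are all
equal to an entry of a product of matrices chosen by the colors. The matrix `!![1, 1; 0, 1]` gives
the value `n + 1` at height `n`, and the scalars `1` and `2` give the values `2 ^ i` with `i ≤ n`.
The trees common to these two languages have exactly the heights `2 ^ i - 1`, the gaps between which are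
unbounded.
-/

namespace SWTA

/-! ### Labels and sums of trees -/

namespace TreeOfHeight

variable {A : Type*}

/-- The tree `smul 0 t` retains only the labels of `t`; trees for which it agrees can be added. -/
theorem exists_add_eq_some {n : ℕ} {s t : TreeOfHeight A n} (h : smul 0 s = smul 0 t) :
    ∃ r, add s t = some r ∧ smul 0 r = smul 0 s := by
  induction s with
  | leaf x => cases t with
    | leaf y => exact ⟨leaf (x + y), by simp [add], by simp [smul]⟩
  | node a l r ihl ihr => cases t with
    | node b l' r' =>
      simp only [smul, node.injEq] at h
      obtain ⟨rfl, hl, hr⟩ := h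
      obtain ⟨u, hu, hu'⟩ := ihl hl
      obtain ⟨v, hv, hv'⟩ := ihr hr
      exact ⟨node a u v, by simp [add, hu, hv], by simp [smul, hu', hv']⟩

theorem smul_zero_smul {n : ℕ} (c : ℂ) (t : TreeOfHeight A n) :
    smul 0 (smul c t) = smul 0 t := by
  induction t with
  | leaf x => simp [smul]
  | node a l r ihl ihr => simp [smul, ihl, ihr]

theorem isSome_of_sumList_isSome {n : ℕ} {l : List (Option (TreeOfHeight A n))}
    (h : (sumList l).isSome) : ∀ o ∈ l, o.isSome := by
  induction l with
  | nil => simp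
  | cons x l ih => cases l with
    | nil => simpa [sumList] using h
    | cons y l =>
      simp only [sumList, oadd] at h
      cases x with
      | none => simp at h
      | some x =>
        cases hy : sumList (y :: l) with
        | none => simp [hy] at h
        | some z =>
          intro o ho
          rcases List.mem_cons.1 ho with rfl | ho
          · rfl
          · exact ih (by simp [hy]) o ho

theorem exists_sumList_eq_some {n : ℕ} {s : TreeOfHeight A n}
    {l : List (Option (TreeOfHeight A n))} (hl : l ≠ [])
    (h : ∀ o ∈ l, ∃ t, o = some t ∧ smul 0 t = s) :
    ∃ t, sumList l = some t ∧ smul 0 t = s := by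
  induction l with
  | nil => exact absurd rfl hl
  | cons x l ih => cases l with
    | nil => simpa [sumList] using h
    | cons y l =>
      obtain ⟨t, rfl, ht⟩ := h x (by simp)
      obtain ⟨u, hu, hu'⟩ := ih (by simp) fun o ho => h o (List.mem_cons_of_mem _ ho)
      obtain ⟨r, hr, hr'⟩ := exists_add_eq_some (ht.trans hu'.symm)
      exact ⟨r, by simp [sumList, oadd, hu, hr], hr'.trans ht⟩

end TreeOfHeight

open TreeOfHeight

namespace LinForm

variable {A : Type*} {Q : Type}

theorem term_isSome {n : ℕ} {v : LinForm Q} {τ : Q → Option (TreeOfHeight A n)} {q : Q} :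
    (v.term τ q).isSome ↔ (v.coeff q).isSome ∧ (τ q).isSome := by
  unfold term
  cases v.coeff q <;> simp

variable [Fintype Q]

theorem isSome_of_eval_isSome {n : ℕ} {v : LinForm Q} {τ : Q → Option (TreeOfHeight A n)}
    (h : (v.eval τ).isSome) (q : Q) (hq : (v.coeff q).isSome) : (τ q).isSome :=
  (term_isSome.1 (isSome_of_sumList_isSome h _
    (List.mem_map_of_mem (by simpa [supp] using hq)))).2

/-- A linear form can be evaluated at trees with the same labels, and the result has these
labels. -/
theorem exists_eval_eq_some {n : ℕ} {v : LinForm Q} {τ : Q → Option (TreeOfHeight A n)}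
    {s : TreeOfHeight A n} (hs : ∀ q t, τ q = some t → smul 0 t = s)
    (h : ∀ q, (v.coeff q).isSome → (τ q).isSome) :
    ∃ t, v.eval τ = some t ∧ smul 0 t = s := by
  refine exists_sumList_eq_some ?_ ?_
  · obtain ⟨q, hq⟩ := v.nonempty
    exact List.ne_nil_of_mem (List.mem_map_of_mem (a := q) (by simpa [supp] using hq))
  · simp only [List.mem_map, Finset.mem_toList, supp, Finset.mem_filter, Finset.mem_univ,
      true_and, forall_exists_index, and_imp, forall_apply_eq_imp_iff₂]
    intro q hq
    obtain ⟨c, hc⟩ := Option.isSome_iff_exists.1 hq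
    obtain ⟨t, ht⟩ := Option.isSome_iff_exists.1 (h q hq)
    exact ⟨smul c t, by simp [term, hc, ht], by rw [smul_zero_smul, hs q t ht]⟩

end LinForm

/-! ### Heights of the trees in a language -/

namespace Automaton

variable {A : Type*} (K : Automaton A)

/-- All the trees produced by a word have the same labels. -/
theorem exists_labels (w : List (A × K.Color)) :
    ∃ s, ∀ q t, K.treeFun w q = some t → smul 0 t = s := by
  induction w with
  | nil =>
    refine ⟨leaf 0, fun q t h => ?_⟩
    simp only [treeFun] at h
    split_ifs at h
    cases h
    simp [smul]
  | cons x u ih =>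
    obtain ⟨a, c⟩ := x
    obtain ⟨s, hs⟩ := ih
    refine ⟨node a s s, fun q t h => ?_⟩
    simp only [treeFun, Option.bind_eq_some_iff, Option.map_eq_some_iff] at h
    obtain ⟨lr, -, tl, hl, tr, hr, rfl⟩ := h
    have key (v : LinForm K.State) (t) (ht : v.eval (K.treeFun u) = some t) :
        smul 0 t = s := by
      obtain ⟨t', ht', h'⟩ := LinForm.exists_eval_eq_some hs
        (LinForm.isSome_of_eval_isSome (v := v) (by simp [ht]))
      rw [ht] at ht'
      cases ht'
      exact h'
    simp [smul, key _ _ hl, key _ _ hr]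

/-- The states whose tree function is defined at the word `w`. -/
def definedStates (w : List (A × K.Color)) : Set K.State := {q | (K.treeFun w q).isSome}

/-- The states with a transition along `x` into linear forms supported in `S`. -/
def predecessors (x : A × K.Color) (S : Set K.State) : Set K.State :=
  {q | ∃ lr, K.trans q x.1 x.2 = some lr ∧
    (∀ p, (lr.1.coeff p).isSome → p ∈ S) ∧ ∀ p, (lr.2.coeff p).isSome → p ∈ S}

theorem definedStates_cons (x : A × K.Color) (w : List (A × K.Color)) :
    K.definedStates (x :: w) = K.predecessors x (K.definedStates w) := by
  obtain ⟨a, c⟩ := x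
  ext q
  constructor
  · intro h
    obtain ⟨t, ht⟩ := Option.isSome_iff_exists.1 h
    simp only [treeFun, Option.bind_eq_some_iff, Option.map_eq_some_iff] at ht
    obtain ⟨lr, h, tl, hl, tr, hr, -⟩ := ht
    exact ⟨lr, h, LinForm.isSome_of_eval_isSome (by simp [hl]),
      LinForm.isSome_of_eval_isSome (by simp [hr])⟩
  · rintro ⟨lr, h, hl, hr⟩
    obtain ⟨s, hs⟩ := K.exists_labels w
    obtain ⟨tl, hl, -⟩ := LinForm.exists_eval_eq_some hs hl
    obtain ⟨tr, hr, -⟩ := LinForm.exists_eval_eq_some hs hr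
    simp only at h
    simp [definedStates, treeFun, h, hl, hr]

/-- The map on families of sets of states induced by prefixing words with one letter. -/
def predecessorFamily (F : Set (Set K.State)) : Set (Set K.State) :=
  {T | ∃ x, ∃ S ∈ F, T = K.predecessors x S}

theorem mem_iterate_predecessorFamily (n : ℕ) (S : Set K.State) :
    S ∈ K.predecessorFamily^[n] {K.definedStates []} ↔
      ∃ w : List (A × K.Color), w.length = n ∧ K.definedStates w = S := by
  induction n generalizing S with
  | zero => simp [eq_comm]
  | succ n ih =>
    rw [Function.iterate_succ_apply']
    constructor
    · rintro ⟨x, T, hT, rfl⟩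
      obtain ⟨w, rfl, rfl⟩ := (ih T).1 hT
      exact ⟨x :: w, rfl, K.definedStates_cons x w⟩
    · rintro ⟨w, hw, rfl⟩
      cases w with
      | nil => simp at hw
      | cons x w =>
        exact ⟨x, _, (ih _).2 ⟨w, by simpa using hw, rfl⟩, K.definedStates_cons x w⟩

/-- The heights of the trees in the language. -/
def heights : Set ℕ := Sigma.fst '' K.language

theorem mem_heights {n : ℕ} :
    n ∈ K.heights ↔ ∃ S ∈ K.predecessorFamily^[n] {K.definedStates []}, K.root ∈ S := by
  simp only [mem_iterate_predecessorFamily]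
  constructor
  · rintro ⟨_, ⟨w, s, h, rfl⟩, rfl⟩
    exact ⟨_, ⟨w, rfl, rfl⟩, by simp [definedStates, h]⟩
  · rintro ⟨_, ⟨w, rfl, rfl⟩, h⟩
    obtain ⟨s, hs⟩ := Option.isSome_iff_exists.1 h
    exact ⟨_, ⟨w, s, hs, rfl⟩, rfl⟩

theorem heights_eventually_periodic :
    ∃ N p, 0 < p ∧ ∀ n, N ≤ n → (n ∈ K.heights ↔ n + p ∈ K.heights) := by
  obtain ⟨i, j, hij, h⟩ := Finite.exists_ne_map_eq_of_infinite
    fun n => K.predecessorFamily^[n] {K.definedStates []}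
  wlog hlt : i < j generalizing i j
  · exact this j i hij.symm h.symm (by omega)
  refine ⟨i, j - i, by omega, fun n hn => ?_⟩
  obtain ⟨k, rfl⟩ := Nat.exists_eq_add_of_le' hn
  have hk : k + i + (j - i) = k + j := by omega
  rw [mem_heights, mem_heights, hk, Function.iterate_add_apply, h, ← Function.iterate_add_apply]

theorem language_countable [Finite A] : K.language.Countable := by
  have : K.language ⊆ ⋃ w : List (A × K.Color),
      (fun s => (⟨w.length, s⟩ : PerfectTree A)) '' {s | K.treeFun w K.root = some s} := by
    rintro _ ⟨w, s, h, rfl⟩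
    exact Set.mem_iUnion.2 ⟨w, s, h, rfl⟩
  refine (Set.countable_iUnion fun w => Set.Countable.image ?_ _).mono this
  refine Set.Subsingleton.countable fun s hs t ht => ?_
  exact Option.some_injective _ (hs.symm.trans ht)

end Automaton

theorem not_countable_univ_perfectTree (A : Type*) :
    ¬ (Set.univ : Set (PerfectTree A)).Countable := by
  intro h
  have hinj : Function.Injective fun z : ℂ => (⟨0, leaf z⟩ : PerfectTree A) := by
    intro x y hxy
    simpa using hxy
  exact not_countable_complex (by simpa using h.preimage hinj)

/-! ### Constant trees whose value is given by a product of matrices -/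

/-- The tree of height `n` with all labels equal to `a` and all leaves equal to `z`. -/
def constTree {A : Type*} (a : A) : (n : ℕ) → ℂ → TreeOfHeight A n
  | 0, z => leaf z
  | n + 1, z => node a (constTree a n z) (constTree a n z)

section ConstTree

variable {A : Type*} (a : A)

theorem constTree_injective (n : ℕ) : Function.Injective (constTree a n) := by
  induction n with
  | zero => intro x y h; simpa [constTree] using h
  | succ n ih => intro x y h; exact ih (by simpa [constTree] using h)

theorem add_constTree (n : ℕ) (x y : ℂ) :
    add (constTree a n x) (constTree a n y) = some (constTree a n (x + y)) := by
  induction n with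
  | zero => simp [constTree, add]
  | succ n ih => simp [constTree, add, ih]

theorem smul_constTree (n : ℕ) (c x : ℂ) :
    smul c (constTree a n x) = constTree a n (c * x) := by
  induction n with
  | zero => simp [constTree, smul]
  | succ n ih => simp [constTree, smul, ih]

theorem sumList_constTree {Q : Type} (n : ℕ) (f : Q → ℂ) {l : List Q} (hl : l ≠ []) :
    sumList (l.map fun q => some (constTree a n (f q))) =
      some (constTree a n (l.map f).sum) := by
  induction l with
  | nil => exact absurd rfl hl
  | cons x l ih => cases l with
    | nil => simp [sumList]
    | cons y l =>
      have := ih (by simp)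
      simp only [List.map_cons] at this
      simp [sumList, this, oadd, add_constTree]

variable {Q : Type} [Fintype Q] [Nonempty Q]

/-- The everywhere defined linear form with the given coefficients. -/
def totalForm (f : Q → ℂ) : LinForm Q where
  coeff q := some (f q)
  nonempty := ⟨Classical.arbitrary Q, rfl⟩

theorem eval_totalForm (n : ℕ) (f g : Q → ℂ) :
    (totalForm f).eval (fun q => some (constTree a n (g q))) =
      some (constTree a n (∑ q, f q * g q)) := by
  have hs : (totalForm f).supp = Finset.univ := by simp [LinForm.supp, totalForm]
  have ht : ((totalForm f).term fun q => some (constTree a n (g q))) =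
      fun q => some (constTree a n (f q * g q)) := by
    funext q
    simp [LinForm.term, totalForm, smul_constTree]
  rw [LinForm.eval, hs, ht, sumList_constTree a n _ (by simp [Finset.univ_nonempty.ne_empty]),
    Finset.sum_map_toList]

variable {C : Type} [Fintype C] [Nonempty C]

open Classical in
/-- The automaton, reading only the symbol `a`, in which a state `q` and a color `c` lead on both
sides to the linear form given by row `q` of the matrix `μ c`. All the states are leaf states. -/
noncomputable abbrev matrixAutomaton (μ : C → Matrix Q Q ℂ) (q₀ : Q) : Automaton A where
  State := Q
  Color := C
  trans q b c := if b = a then some (totalForm (μ c q), totalForm (μ c q)) else none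
  root := q₀
  leafStates := Set.univ

/-- The vector of leaf values produced by the matrices of a word. -/
def matrixValue (μ : C → Matrix Q Q ℂ) : List C → Q → ℂ
  | [], _ => 1
  | c :: w, q => ∑ p, μ c q p * matrixValue μ w p

theorem treeFun_matrixAutomaton (μ : C → Matrix Q Q ℂ) (q₀ : Q) (w : List (A × C))
    (hw : ∀ x ∈ w, x.1 = a) :
    (matrixAutomaton a μ q₀).treeFun w =
      fun q => some (constTree a w.length (matrixValue μ (w.map Prod.snd) q)) := by
  induction w with
  | nil => funext q; simp [Automaton.treeFun, matrixAutomaton, matrixValue, constTree]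
  | cons x w ih =>
    obtain ⟨b, c⟩ := x
    obtain rfl : b = a := hw (b, c) (by simp)
    funext q
    have ih := ih fun x hx => hw x (List.mem_cons_of_mem _ hx)
    have ht : (matrixAutomaton b μ q₀).trans q b c =
        some (totalForm (μ c q), totalForm (μ c q)) := if_pos rfl
    rw [Automaton.treeFun, ht, ih]
    have he := eval_totalForm b w.length (μ c q) (matrixValue μ (w.map Prod.snd))
    change ((totalForm (μ c q)).eval _).bind (fun tl => ((totalForm (μ c q)).eval _).map _) = _
    erw [he]
    rfl

theorem symbol_eq_of_treeFun_matrixAutomaton (μ : C → Matrix Q Q ℂ) (q₀ : Q)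
    (w : List (A × C)) (q : Q) (h : ((matrixAutomaton a μ q₀).treeFun w q).isSome) :
    ∀ x ∈ w, x.1 = a := by
  induction w generalizing q with
  | nil => simp
  | cons x w ih =>
    have h : q ∈ (matrixAutomaton a μ q₀).definedStates (x :: w) := h
    rw [Automaton.definedStates_cons] at h
    obtain ⟨lr, hlr, hl, -⟩ := h
    have hx : x.1 = a := by
      by_contra hx
      simp [matrixAutomaton, hx] at hlr
    obtain ⟨p, hp⟩ := lr.1.nonempty
    intro y hy
    rcases List.mem_cons.1 hy with rfl | hy
    · exact hx
    · exact ih p (hl p hp) y hy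

theorem mem_language_matrixAutomaton (μ : C → Matrix Q Q ℂ) (q₀ : Q) (t : PerfectTree A) :
    t ∈ (matrixAutomaton a μ q₀).language ↔
      ∃ u : List C, t = ⟨u.length, constTree a u.length (matrixValue μ u q₀)⟩ := by
  -- The lengths of a word and of its list of colors agree only propositionally.
  have key (n m : ℕ) (h : n = m) (z : ℂ) :
      (⟨n, constTree a n z⟩ : PerfectTree A) = ⟨m, constTree a m z⟩ := by rw [h]
  constructor
  · rintro ⟨w, s, h, rfl⟩
    have hw := symbol_eq_of_treeFun_matrixAutomaton a μ q₀ w q₀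
      (Option.isSome_iff_exists.2 ⟨s, h⟩)
    rw [treeFun_matrixAutomaton a μ q₀ w hw] at h
    cases h
    exact ⟨w.map Prod.snd, key _ _ (by simp) _⟩
  · rintro ⟨u, rfl⟩
    refine ⟨u.map fun c => (a, c), _,
      congrFun (treeFun_matrixAutomaton a μ q₀ (u.map fun c => (a, c)) (by simp)) q₀, ?_⟩
    rw [List.map_map]
    have : Prod.snd ∘ (fun c : C => (a, c)) = id := rfl
    rw [this, List.map_id]
    exact key _ _ (by simp) _

end ConstTree

/-! ### Two languages whose common trees have sparse heights -/

theorem matrixValue_unipotent (u : List Unit) :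
    matrixValue (fun _ : Unit => !![(1 : ℂ), 1; 0, 1]) u =
      ![(u.length : ℂ) + 1, 1] := by
  induction u with
  | nil => funext q; fin_cases q <;> simp [matrixValue]
  | cons c u ih =>
    funext q
    fin_cases q <;> simp [matrixValue, ih]

theorem matrixValue_pow_two (u : List Bool) (q : Unit) :
    matrixValue (fun b _ _ => if b then (2 : ℂ) else 1) u q = 2 ^ u.count true := by
  induction u with
  | nil => simp [matrixValue]
  | cons c u ih => cases c <;> simp [matrixValue, ih, pow_succ, mul_comm]

/-- The automaton whose language consists of the constant trees of height `n` and value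
`n + 1`. -/
noncomputable def succAutomaton {A : Type*} (a : A) : Automaton A :=
  matrixAutomaton a (fun _ : Unit => !![(1 : ℂ), 1; 0, 1]) 0

/-- The automaton whose language consists of the constant trees of height `n` and value
`2 ^ i` with `i ≤ n`. -/
noncomputable def powTwoAutomaton {A : Type*} (a : A) : Automaton A :=
  matrixAutomaton a (fun (b : Bool) (_ _ : Unit) => if b then (2 : ℂ) else 1) ()

theorem mem_heights_inter {A : Type*} (a : A) (n : ℕ) :
    n ∈ Sigma.fst '' ((succAutomaton a).language ∩ (powTwoAutomaton a).language) ↔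
      ∃ i, n + 1 = 2 ^ i := by
  constructor
  · rintro ⟨t, ⟨h₁, h₂⟩, rfl⟩
    obtain ⟨u, rfl⟩ := (mem_language_matrixAutomaton a _ _ _).1 h₁
    obtain ⟨v, h⟩ := (mem_language_matrixAutomaton a _ _ _).1 h₂
    rw [matrixValue_unipotent, matrixValue_pow_two] at h
    rw [Sigma.mk.injEq] at h
    obtain ⟨h, h'⟩ := h
    rw [← h] at h'
    refine ⟨v.count true, ?_⟩
    have := constTree_injective a _ (eq_of_heq h')
    simp only [Matrix.cons_val_zero] at this
    exact_mod_cast this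
  · rintro ⟨i, hi⟩
    have hin : i ≤ n := by
      have := Nat.lt_two_pow_self (n := i)
      omega
    refine ⟨⟨n, constTree a n (n + 1)⟩, ⟨?_, ?_⟩, rfl⟩
    · refine (mem_language_matrixAutomaton a _ _ _).2 ⟨List.replicate n (), ?_⟩
      rw [matrixValue_unipotent, List.length_replicate]
      rfl
    · refine (mem_language_matrixAutomaton a _ _ _).2
        ⟨List.replicate i true ++ List.replicate (n - i) false, ?_⟩
      have hc : (List.replicate i true ++ List.replicate (n - i) false).count true = i := by
        simp [List.count_replicate]
      have hl : (List.replicate i true ++ List.replicate (n - i) false).length = n := by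
        simp [hin]
      have hz : ((n : ℂ) + 1) = 2 ^ i := by exact_mod_cast hi
      rw [matrixValue_pow_two, hc, hl, hz]

end SWTA

/-- Over every (finite non-empty) alphabet, the class of languages of synchronized weighted tree
automata is closed neither under intersection nor under complement (in the set of all perfect
trees over the alphabet). -/
theorem mainTheorem11 (A : Type*) [Finite A] [Nonempty A] :
    (∃ M N : SWTA.Automaton A, ¬ ∃ K : SWTA.Automaton A,
      K.language = M.language ∩ N.language) ∧
    (∃ M : SWTA.Automaton A, ¬ ∃ K : SWTA.Automaton A,
      K.language = (M.language)ᶜ) := by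
  have a : A := Classical.arbitrary A
  refine ⟨⟨SWTA.succAutomaton a, SWTA.powTwoAutomaton a, ?_⟩, SWTA.succAutomaton a, ?_⟩
  · rintro ⟨K, hK⟩
    have hh (n : ℕ) : n ∈ K.heights ↔ ∃ i, n + 1 = 2 ^ i := by
      rw [SWTA.Automaton.heights, hK]
      exact SWTA.mem_heights_inter a n
    obtain ⟨N, p, hp, h⟩ := K.heights_eventually_periodic
    -- The height `2 ^ i - 1` is at least `N`, and its distance to the next height exceeds `p`.
    obtain ⟨i, hi⟩ : ∃ i, i = N + p := ⟨_, rfl⟩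
    have hlt : N + p < 2 ^ i := hi ▸ Nat.lt_two_pow_self
    obtain ⟨j, hj⟩ := (hh _).1 ((h (2 ^ i - 1) (by omega)).1 ((hh _).2 ⟨i, by omega⟩))
    have h₁ : i < j := (Nat.pow_lt_pow_iff_right (a := 2) (by norm_num)).1 (by omega)
    have h₂ : j < i + 1 := (Nat.pow_lt_pow_iff_right (a := 2) (by norm_num)).1 (by
      rw [pow_succ]; omega)
    omega
  · rintro ⟨K, hK⟩
    refine SWTA.not_countable_univ_perfectTree A ?_
    rw [← Set.union_compl_self (SWTA.succAutomaton a).language, ← hK]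
    exact (SWTA.Automaton.language_countable _).union K.language_countable
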